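/- For each integer $n \ge 0$ let $B_n$ be the algebra on $\{0,1,\dots,2^n-1\}$ with the binary operation $\backslash_n$ determined by the recursive equations $0 \backslash_n x = x$; $\ x \backslash_n (2^n-1) = x-1$ for $x>0$; and $x \backslash_n (y-1) = (x \backslash_n y)\backslash_n (x-1)$ for $x,y>0$. For $n \le N$ the algebra $B_n$ is a subalgebra of $B_N$; let $B_\infty$, with operation $\backslash$, be the union of the algebras $B_n$, an algebra on the set of all nonnegative integers. For a nonnegative integer $x$ let $\langle x\rangle$ denote the subalgebra of $B_\infty$ generated by $x$, and for $x>0$ let the period length of $x$ be the least period of the sequence $x\backslash 0,\ x\backslash 1,\ x\backslash 2,\dots$. Theorem 4.1. Let $a,x,y,m,n,l$ be nonnegative integers such that $a = x + 2^{mn}y$, $n$ is a power of $2$ (possibly $n = 1$), $y<2^n$, $2^{(m+1)n} \mid x$, the period length of $x+1$ in $B_\infty$ is $2^l$, and $l \le n$. Put $b = 2^{l+n}-2^n+y$. Then $\langle a\rangle$ is isomorphic to $\langle b\rangle$. More precisely, $(b+1)\backslash i \in \langle b\rangle$ for every $i \ge 0$, and there is an isomorphism $\phi:\langle b\rangle \to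 \langle a\rangle$ with $\phi((b+1)\backslash i) = (a+1)\backslash i$ for all $i \ge 0$; and for all nonnegative integers $i,w,y'$ with $y'<2^n$ and $(b+1)\backslash i = 2^n w + y'$ we have $$(a+1)\backslash i = (x+1)\backslash w + 2^{mn}y'.$$ -/

import Mathlib

namespace BackwardLaver

/-- The rows of the finite backward Laver tables, read from the right:
`row n x k` is the entry `(x + 1) \_n (2 ^ n - 1 - k)`. The subtype records `(x + 1) \_n y < x + 1`,
which makes the recursion well founded. -/
def row (n : ℕ) : (x : ℕ) → (k : ℕ) → {z : ℕ // z ≤ x}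
  | x, 0 => ⟨x, le_rfl⟩
  | x, k + 1 =>
    match row n x k with
    | ⟨0, _⟩ => ⟨x, le_rfl⟩
    | ⟨z + 1, h⟩ => ⟨(row n z (2 ^ n - 1 - x)).1, (row n z (2 ^ n - 1 - x)).2.trans (by omega)⟩
termination_by x k => (x, k)

/-- The operation `x \_n y` of the algebra `B_n` with underlying set `{0, 1, …, 2 ^ n - 1}`.
It is meant for arguments `x, y < 2 ^ n`, where it is determined by the recursive equations
`finOp_zero`, `finOp_last` and `finOp_pred` below. -/
def finOp (n : ℕ) : ℕ → ℕ → ℕ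
  | 0, y => y
  | x + 1, y => (row n x (2 ^ n - 1 - y)).1

theorem finOp_zero (n y : ℕ) : finOp n 0 y = y := rfl

theorem finOp_last (n x : ℕ) (hx : 0 < x) : finOp n x (2 ^ n - 1) = x - 1 := by
  obtain ⟨x, rfl⟩ := Nat.exists_eq_succ_of_ne_zero hx.ne'
  simp [finOp, row]

theorem finOp_pred (n x y : ℕ) (hx : 0 < x) (hy : 0 < y) (hyn : y < 2 ^ n) :
    finOp n x (y - 1) = finOp n (finOp n x y) (x - 1) := by
  obtain ⟨x, rfl⟩ := Nat.exists_eq_succ_of_ne_zero hx.ne'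
  have h : 2 ^ n - 1 - (y - 1) = (2 ^ n - 1 - y) + 1 := by omega
  simp only [finOp, Nat.succ_eq_add_one, h, Nat.add_sub_cancel]
  rw [row]
  rcases row n x (2 ^ n - 1 - y) with ⟨_ | z, hz⟩ <;> rfl

theorem finOp_lt_left (n x y : ℕ) (hx : 0 < x) : finOp n x y < x := by
  obtain ⟨x, rfl⟩ := Nat.exists_eq_succ_of_ne_zero hx.ne'
  exact Nat.lt_succ_of_le (row n x _).2

/-- `{0, 1, …, 2 ^ n - 1}` is closed under the operation of `B_n`. -/
theorem finOp_lt (n x y : ℕ) (hx : x < 2 ^ n) (hy : y < 2 ^ n) : finOp n x y < 2 ^ n := by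
  rcases Nat.eq_zero_or_pos x with rfl | h
  · exact hy
  · exact (finOp_lt_left n x y h).trans hx

/-! The next facts show that `B_n` is a subalgebra of `B_N` for `n ≤ N`, so that the union of the
`B_n` makes sense. -/

theorem row_zero (n x : ℕ) : (row n x 0).1 = x := by rw [row]

theorem row_succ (n x k : ℕ) : (row n x (k + 1)).1 = finOp n (row n x k).1 x := by
  rw [row]
  rcases row n x k with ⟨_ | z, hz⟩ <;> rfl

theorem finOp_succ (n x y : ℕ) : finOp n (x + 1) y = (row n x (2 ^ n - 1 - y)).1 := rfl

theorem row_add (n x q : ℕ) (h : (row n x q).1 = 0) (k : ℕ) :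
    (row n x (k + (q + 1))).1 = (row n x k).1 := by
  induction k with
  | zero => rw [Nat.zero_add, row_succ, h, row_zero]; rfl
  | succ k ih => rw [Nat.add_right_comm, row_succ, ih, ← row_succ]

theorem row_mul (n x p : ℕ) (h : ∀ k, (row n x (k + p)).1 = (row n x k).1) (c k : ℕ) :
    (row n x (k + c * p)).1 = (row n x k).1 := by
  induction c with
  | zero => simp
  | succ c ih => rw [Nat.succ_mul, ← Nat.add_assoc, h, ih]

/-- The first zero in each row of `B_n`, read from the right, is at a power of two. -/
def RowPeriods (n : ℕ) : Prop :=
  ∀ x, x + 1 < 2 ^ n → ∃ j ≤ n, (row n x (2 ^ j - 1)).1 = 0 ∧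
    ∀ k < 2 ^ j - 1, (row n x k).1 ≠ 0

theorem row_add_two_pow {n : ℕ} (H : RowPeriods n) (x : ℕ) (hx : x + 1 < 2 ^ n) (k : ℕ) :
    (row n x (k + 2 ^ n)).1 = (row n x k).1 := by
  obtain ⟨j, hj, h0, -⟩ := H x hx
  have h1 := row_add n x _ h0
  rw [Nat.sub_add_cancel Nat.one_le_two_pow] at h1
  have := row_mul n x _ h1 (2 ^ (n - j)) k
  rwa [← pow_add, Nat.sub_add_cancel hj] at this

theorem row_mod_aux {n x : ℕ} (hx : x < 2 ^ (n + 1))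
    (ih : ∀ u ≤ x, ∀ v < 2 ^ (n + 1),
      finOp (n + 1) u v % 2 ^ n = finOp n (u % 2 ^ n) (v % 2 ^ n)) (k : ℕ) :
    (row (n + 1) x (k + 1)).1 % 2 ^ n =
      finOp n ((row (n + 1) x k).1 % 2 ^ n) (x % 2 ^ n) := by
  rw [row_succ, ih _ (row (n + 1) x k).2 _ hx]

theorem row_mod_of_lt {n x : ℕ} (hx : x < 2 ^ (n + 1))
    (ih : ∀ u ≤ x, ∀ v < 2 ^ (n + 1),
      finOp (n + 1) u v % 2 ^ n = finOp n (u % 2 ^ n) (v % 2 ^ n)) (k : ℕ) :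
    (row (n + 1) x k).1 % 2 ^ n = (row n (x % 2 ^ n) k).1 := by
  induction k with
  | zero => rw [row_zero, row_zero]
  | succ k hk => rw [row_mod_aux hx ih, hk, ← row_succ]

theorem row_mod_of_eq {n x : ℕ} (hx : x < 2 ^ (n + 1)) (hx' : x % 2 ^ n = 2 ^ n - 1)
    (ih : ∀ u ≤ x, ∀ v < 2 ^ (n + 1),
      finOp (n + 1) u v % 2 ^ n = finOp n (u % 2 ^ n) (v % 2 ^ n)) (k : ℕ) (hk : k < 2 ^ n) :
    (row (n + 1) x k).1 % 2 ^ n = 2 ^ n - 1 - k := by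
  induction k with
  | zero => rw [row_zero, hx', Nat.sub_zero]
  | succ k h =>
    rw [row_mod_aux hx ih, h (by omega), hx', finOp_last _ _ (by omega)]
    omega

theorem finOp_mod {n : ℕ} (H : RowPeriods n) (u : ℕ) (hu : u < 2 ^ (n + 1)) :
    ∀ v < 2 ^ (n + 1), finOp (n + 1) u v % 2 ^ n = finOp n (u % 2 ^ n) (v % 2 ^ n) := by
  have h2 : 2 ^ (n + 1) = 2 ^ n + 2 ^ n := by ring
  have hp : 0 < 2 ^ n := by positivity
  induction u using Nat.strong_induction_on with
  | _ u IH =>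
  intro v hv
  rcases u with _ | x
  · simp [finOp_zero]
  have ih : ∀ u ≤ x, ∀ v < 2 ^ (n + 1),
      finOp (n + 1) u v % 2 ^ n = finOp n (u % 2 ^ n) (v % 2 ^ n) :=
    fun u hu' v hv => IH u (by omega) (by omega) v hv
  have hxl := Nat.mod_lt x hp
  by_cases hx' : x % 2 ^ n = 2 ^ n - 1
  · have h0 : (x + 1) % 2 ^ n = 0 := by
      rw [Nat.add_mod_eq_ite]
      rcases Nat.lt_or_ge 1 (2 ^ n) with h1 | h1
      · rw [Nat.mod_eq_of_lt h1]; split_ifs <;> omega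
      · have : 2 ^ n = 1 := by omega
        simp [this, Nat.mod_one]
    have key := row_mod_of_eq (by omega) hx' ih
    have hxr : (row (n + 1) x (2 ^ n)).1 % 2 ^ n = 2 ^ n - 1 := by
      have := row_mod_aux (by omega : x < 2 ^ (n + 1)) ih (2 ^ n - 1)
      rw [Nat.sub_add_cancel hp, key (2 ^ n - 1) (by omega), Nat.sub_self, finOp_zero, hx'] at this
      exact this
    have key2 : ∀ k < 2 ^ n, (row (n + 1) x (k + 2 ^ n)).1 % 2 ^ n = 2 ^ n - 1 - k := by
      intro k hk
      induction k with
      | zero => rw [Nat.zero_add, hxr, Nat.sub_zero]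
      | succ k h =>
        rw [Nat.add_right_comm, row_mod_aux (by omega) ih, h (by omega), hx',
          finOp_last _ _ (by omega)]
        omega
    rw [h0, finOp_zero, finOp_succ]
    rcases Nat.lt_or_ge v (2 ^ n) with hvn | hvn
    · have : 2 ^ (n + 1) - 1 - v = (2 ^ n - 1 - v) + 2 ^ n := by omega
      rw [this, key2 _ (by omega), Nat.mod_eq_of_lt hvn]
      omega
    · rw [key _ (by omega), Nat.mod_eq_sub_mod hvn,
        Nat.mod_eq_of_lt (show v - 2 ^ n < 2 ^ n by omega)]
      omega
  · have h0 : (x + 1) % 2 ^ n = x % 2 ^ n + 1 := by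
      rw [← Nat.mod_add_mod, Nat.mod_eq_of_lt (by omega)]
    rw [h0, finOp_succ, finOp_succ, row_mod_of_lt (by omega) ih]
    rcases Nat.lt_or_ge v (2 ^ n) with hvn | hvn
    · have : 2 ^ (n + 1) - 1 - v = (2 ^ n - 1 - v) + 2 ^ n := by omega
      rw [this, row_add_two_pow H _ (by omega), Nat.mod_eq_of_lt hvn]
    · rw [Nat.mod_eq_sub_mod hvn, Nat.mod_eq_of_lt (show v - 2 ^ n < 2 ^ n by omega)]
      congr 2
      omega

theorem rowPeriods_succ {n : ℕ} (H : RowPeriods n) : RowPeriods (n + 1) := by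
  have h2 : 2 ^ (n + 1) = 2 ^ n + 2 ^ n := by ring
  have hp : 0 < 2 ^ n := by positivity
  intro x hx
  have ih : ∀ u ≤ x, ∀ v < 2 ^ (n + 1),
      finOp (n + 1) u v % 2 ^ n = finOp n (u % 2 ^ n) (v % 2 ^ n) :=
    fun u hu v hv => finOp_mod H u (by omega) v hv
  have hxl := Nat.mod_lt x hp
  by_cases hx' : x % 2 ^ n = 2 ^ n - 1
  · have key := row_mod_of_eq (by omega) hx' ih
    have hxe : x = 2 ^ n - 1 := by
      rcases Nat.lt_or_ge x (2 ^ n) with h | h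
      · rwa [Nat.mod_eq_of_lt h] at hx'
      · rw [Nat.mod_eq_sub_mod h, Nat.mod_eq_of_lt (by omega)] at hx'; omega
    refine ⟨n, by omega, ?_, fun k hk h => ?_⟩
    · have h1 := key (2 ^ n - 1) (by omega)
      have h3 := (row (n + 1) x (2 ^ n - 1)).2
      rw [Nat.mod_eq_of_lt (by omega)] at h1
      omega
    · have h1 := key k (by omega)
      rw [h, Nat.zero_mod] at h1
      omega
  · have key := row_mod_of_lt (by omega) ih
    obtain ⟨j, hj, h0, hne⟩ := H (x % 2 ^ n) (by omega)
    have hjp : 0 < 2 ^ j := by positivity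
    have hne' : ∀ k < 2 ^ j - 1, (row (n + 1) x k).1 ≠ 0 := fun k hk h =>
      hne k hk (by rw [← key, h, Nat.zero_mod])
    have hper := row_add n _ _ h0
    rw [Nat.sub_add_cancel hjp] at hper
    by_cases hz : (row (n + 1) x (2 ^ j - 1)).1 = 0
    · exact ⟨j, by omega, hz, hne'⟩
    have hle := (row (n + 1) x (2 ^ j - 1)).2
    have hmod := key (2 ^ j - 1)
    rw [h0] at hmod
    have hval : (row (n + 1) x (2 ^ j - 1)).1 = 2 ^ n := by
      rcases Nat.lt_or_ge (row (n + 1) x (2 ^ j - 1)).1 (2 ^ n) with h | h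
      · rw [Nat.mod_eq_of_lt h] at hmod; omega
      · rw [Nat.mod_eq_sub_mod h, Nat.mod_eq_of_lt (by omega)] at hmod; omega
    have hlt : ∀ k < 2 ^ j, (row (n + 1) x (k + 2 ^ j)).1 < 2 ^ n := by
      intro k hk
      induction k with
      | zero =>
        have := row_succ (n + 1) x (2 ^ j - 1)
        rw [Nat.sub_add_cancel hjp, hval] at this
        rw [Nat.zero_add, this]
        exact finOp_lt_left _ _ _ hp
      | succ k h =>
        have h3 := h (by omega)
        rw [Nat.add_right_comm, row_succ]
        refine (finOp_lt_left _ _ _ (Nat.pos_of_ne_zero fun h4 => ?_)).trans h3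
        apply hne k (by omega)
        rw [← hper, ← key, h4, Nat.zero_mod]
    have hj2 : 2 ^ (j + 1) - 1 = (2 ^ j - 1) + 2 ^ j := by
      have : 2 ^ (j + 1) = 2 ^ j + 2 ^ j := by ring
      omega
    refine ⟨j + 1, by omega, ?_, fun k hk h => ?_⟩
    · have h3 := key ((2 ^ j - 1) + 2 ^ j)
      rw [hper, h0, Nat.mod_eq_of_lt (hlt _ (by omega))] at h3
      rw [hj2, h3]
    · rcases lt_trichotomy k (2 ^ j - 1) with h3 | h3 | h3
      · exact hne' k h3 h
      · rw [h3] at h; exact hz h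
      · obtain ⟨i, rfl⟩ : ∃ i, k = i + 2 ^ j := ⟨k - 2 ^ j, by omega⟩
        apply hne i (by omega)
        rw [← hper, ← key, h, Nat.zero_mod]

theorem rowPeriods (n : ℕ) : RowPeriods n := by
  induction n with
  | zero => intro x hx; simp at hx
  | succ n ih => exact rowPeriods_succ ih

theorem finOp_add_one (n x y : ℕ) (hx : x < 2 ^ n) (hy : y < 2 ^ n) :
    finOp (n + 1) x y = finOp n x y := by
  have h2 : 2 ^ (n + 1) = 2 ^ n + 2 ^ n := by ring
  induction x using Nat.strong_induction_on generalizing y with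
  | _ u IH =>
  rcases u with _ | x
  · rfl
  have key : ∀ k, (row (n + 1) x k).1 = (row n x k).1 := by
    intro k
    induction k with
    | zero => rw [row_zero, row_zero]
    | succ k hk =>
      have := (row n x k).2
      rw [row_succ, hk, IH _ (by omega) x (by omega) (by omega), ← row_succ]
  have h3 : 2 ^ (n + 1) - 1 - y = (2 ^ n - 1 - y) + 2 ^ n := by omega
  rw [finOp_succ, finOp_succ, key, h3, row_add_two_pow (rowPeriods n) x hx]

/-- For `n ≤ N`, the operation of `B_N` restricts to that of `B_n`. -/
theorem finOp_eq_of_le {n N : ℕ} (h : n ≤ N) (x y : ℕ) (hx : x < 2 ^ n) (hy : y < 2 ^ n) :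
    finOp N x y = finOp n x y := by
  induction N, h using Nat.le_induction with
  | base => rfl
  | succ N h ih =>
    have := Nat.pow_le_pow_right (show 0 < 2 by decide) h
    rw [finOp_add_one N x y (by omega) (by omega), ih]

/-- The operation of `B_∞`, the union of the algebras `B_n`, on natural numbers: it is computed in
the least `B_n` which contains both arguments, or in any other one by `op_eq_finOp`. -/
def op (x y : ℕ) : ℕ := finOp (Nat.size (max x y)) x y

infix:70 " ⊳ " => op

theorem op_eq_finOp (n x y : ℕ) (hx : x < 2 ^ n) (hy : y < 2 ^ n) : x ⊳ y = finOp n x y := by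
  have h : max x y < 2 ^ Nat.size (max x y) := Nat.lt_size_self _
  exact (finOp_eq_of_le (Nat.size_le.2 (max_lt hx hy)) x y (by omega) (by omega)).symm

/-- The algebra `B_∞`. Its elements are the natural numbers, wrapped so that the operation of
`B_∞`, written as a multiplication, is not confused with the one of `ℕ`. -/
@[ext]
structure BInf where
  /-- the underlying natural number -/
  val : ℕ

instance : Mul BInf := ⟨fun u v => ⟨u.val ⊳ v.val⟩⟩

/-- The subalgebra of `B_∞` generated by `x`, that is, the smallest set which contains `x` and is
closed under the operation (associativity plays no role for `Subsemigroup`). -/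
def subalg (x : ℕ) : Subsemigroup BInf := Subsemigroup.closure {⟨x⟩}

/-- `p` is the period length of `x` in `B_∞`, i.e. the least period of the sequence
`x ⊳ 0, x ⊳ 1, x ⊳ 2, …`. -/
def IsPeriodLength (x p : ℕ) : Prop :=
  IsLeast {q | 0 < q ∧ Function.Periodic (fun i => x ⊳ i) q} p

end BackwardLaver

open BackwardLaver

namespace BackwardLaver

/-! Read from the right, the row of `a + 1` lists the left powers a, a ⊳ a, (a ⊳ a) ⊳ a, …, and left
distributivity makes this list all of ⟨a⟩ (`mem_subalg_iff`). So it suffices to carry the row of `b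
+ 1` onto that of `a + 1` by an injective map. The map is `digitMap`, which sends b to a because the
row of x + 1 has entry x at 2^l - 1; `digitMap_op` proves that it is a homomorphism on B_(n+l).

That proof rests on `Shifts M l`: if 2^M does not divide u, then 2^(M+l) divides u ⊳ 2^M, so for u ≤
2^(M+l) the row of u has period 2^M. Such u see only the lowest M binary digits of their argument,
while multiples of 2^M act on the upper digits and keep the lower ones (`Shifts.mul_op`,
`Shifts.rowAdds`).

`shifts_two_pow` provides `Shifts M (2^k)` when 2^k ∣ M; this is where powers of two enter. Its
proof treats u as an elementary embedding whose critical point is the exponent of the exact power of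
2 dividing u, and compares u with u ⊳ e for embeddings e whose action on critical points is
controlled. -/

/-! ### Recursion, reduction modulo powers of two, zeros of rows. -/

theorem op_zero_left (y : ℕ) : 0 ⊳ y = y := rfl

theorem exists_lt_two_pow (x y z : ℕ) : ∃ N, x < 2 ^ N ∧ y < 2 ^ N ∧ z < 2 ^ N :=
  ⟨x + y + z, lt_of_le_of_lt (by omega) Nat.lt_two_pow_self,
    lt_of_le_of_lt (by omega) Nat.lt_two_pow_self, lt_of_le_of_lt (by omega) Nat.lt_two_pow_self⟩

theorem op_lt_left {x : ℕ} (y : ℕ) (hx : 0 < x) : x ⊳ y < x := finOp_lt_left _ _ _ hx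

theorem op_last {N x : ℕ} (hx : 0 < x) (hN : x < 2 ^ N) : x ⊳ (2 ^ N - 1) = x - 1 := by
  rw [op_eq_finOp N _ _ hN (by omega), finOp_last _ _ hx]

theorem op_pred {x y : ℕ} (hx : 0 < x) (hy : 0 < y) : x ⊳ (y - 1) = (x ⊳ y) ⊳ (x - 1) := by
  obtain ⟨N, h1, h2, -⟩ := exists_lt_two_pow x y 0
  have h3 := op_lt_left y hx
  rw [op_eq_finOp N x (y - 1) h1 (by omega), op_eq_finOp N (x ⊳ y) _ (by omega) (by omega),
    op_eq_finOp N x y h1 h2, finOp_pred N x y hx hy h2]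

theorem finOp_mod_of_le {n N : ℕ} (h : n ≤ N) (x y : ℕ) (hx : x < 2 ^ N) (hy : y < 2 ^ N) :
    finOp N x y % 2 ^ n = finOp n (x % 2 ^ n) (y % 2 ^ n) := by
  induction N, h using Nat.le_induction generalizing x y with
  | base => rw [Nat.mod_eq_of_lt hx, Nat.mod_eq_of_lt hy, Nat.mod_eq_of_lt (finOp_lt n x y hx hy)]
  | succ N h ih =>
    have hd : 2 ^ n ∣ 2 ^ N := pow_dvd_pow 2 h
    have hp : 0 < 2 ^ N := by positivity
    rw [← Nat.mod_mod_of_dvd _ hd, finOp_mod (rowPeriods N) x hx y hy,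
      ih _ _ (Nat.mod_lt _ hp) (Nat.mod_lt _ hp), Nat.mod_mod_of_dvd _ hd, Nat.mod_mod_of_dvd _ hd]

theorem op_mod (n x y : ℕ) : (x ⊳ y) % 2 ^ n = (x % 2 ^ n) ⊳ (y % 2 ^ n) := by
  have hp : 0 < 2 ^ n := by positivity
  obtain ⟨N, h1, h2, h3⟩ := exists_lt_two_pow x y n
  have h4 : (2 : ℕ) ^ N ≤ 2 ^ (N + n) := Nat.pow_le_pow_right (by decide) (by omega)
  rw [op_eq_finOp (N + n) x y (by omega) (by omega),
    finOp_mod_of_le (Nat.le_add_left n N) _ _ (by omega) (by omega),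
    op_eq_finOp n _ _ (Nat.mod_lt _ hp) (Nat.mod_lt _ hp)]

theorem op_modEq {n x x' y y' : ℕ} (h : x ≡ x' [MOD 2 ^ n]) (h' : y ≡ y' [MOD 2 ^ n]) :
    x ⊳ y ≡ x' ⊳ y' [MOD 2 ^ n] := by
  unfold Nat.ModEq at *
  rw [op_mod, op_mod, h, h']

theorem row_zeros {n x : ℕ} (hx : x + 1 < 2 ^ n) :
    ∃ q ≤ n, ∀ k, (row n x k).1 = 0 ↔ 2 ^ q ∣ k + 1 := by
  obtain ⟨q, hq, h0, hne⟩ := rowPeriods n x hx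
  have hp : 0 < 2 ^ q := by positivity
  refine ⟨q, hq, fun k => ?_⟩
  have hadd := row_add n x _ h0
  rw [Nat.sub_add_cancel hp] at hadd
  have h1 := row_mul n x _ hadd (k / 2 ^ q) (k % 2 ^ q)
  have h2 := Nat.mod_add_div' k (2 ^ q)
  rw [h2] at h1
  have hl := Nat.mod_lt k hp
  have h3 : 2 ^ q ∣ k + 1 ↔ 2 ^ q ∣ k % 2 ^ q + 1 := by
    conv_lhs => rw [← h2, Nat.add_right_comm]
    exact (Nat.dvd_add_iff_left (Dvd.intro_left _ rfl)).symm
  rw [h1, h3]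
  constructor
  · intro h
    by_contra hc
    refine hne _ ?_ h
    have : k % 2 ^ q + 1 ≠ 2 ^ q := fun h => hc (by rw [h])
    omega
  · intro h
    have := Nat.le_of_dvd (by omega) h
    rwa [show k % 2 ^ q = 2 ^ q - 1 by omega]

/-- The positions in the row of `u` at which the entry vanishes modulo `2 ^ j`. -/
theorem exists_dvd_op_iff (u j : ℕ) : ∃ q ≤ j, ∀ t, 2 ^ j ∣ u ⊳ t ↔ 2 ^ q ∣ t := by
  have hp : 0 < 2 ^ j := by positivity
  have hl := Nat.mod_lt u hp
  simp only [Nat.dvd_iff_mod_eq_zero, op_mod]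
  rcases h : u % 2 ^ j with _ | x
  · exact ⟨j, le_rfl, fun t => by rw [op_zero_left]⟩
  · obtain ⟨q, hq, H⟩ := row_zeros (n := j) (x := x) (by omega)
    refine ⟨q, hq, fun t => ?_⟩
    have ht := Nat.mod_lt t hp
    rw [op_eq_finOp j _ _ (by omega) ht, finOp_succ, H,
      show 2 ^ j - 1 - t % 2 ^ j + 1 = 2 ^ j - t % 2 ^ j by omega, ← Nat.dvd_iff_mod_eq_zero,
      Nat.dvd_sub_iff_right ht.le (pow_dvd_pow 2 hq), Nat.dvd_mod_iff (pow_dvd_pow 2 hq)]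

theorem op_zero_right (x : ℕ) : x ⊳ 0 = 0 := by
  obtain ⟨q, -, h⟩ := exists_dvd_op_iff x x
  have h1 := (h 0).2 (dvd_zero _)
  rcases Nat.eq_zero_or_pos x with rfl | hx
  · rfl
  · exact Nat.eq_zero_of_dvd_of_lt h1 ((op_lt_left 0 hx).trans Nat.lt_two_pow_self)

/-! ### Left distributivity, periodicity and growth of rows. -/

/-- Induction on x, then on y, then downward on z = 2^N - 1 - i. The start is `op_pred`; the step
writes y ⊳ (z - 1) as (y ⊳ z) ⊳ (y - 1), and the outer hypotheses apply because y ⊳ z < y and x ⊳ y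
< x. -/
theorem op_op_op_of_lt (N : ℕ) : ∀ x < 2 ^ N, ∀ y < 2 ^ N, ∀ i < 2 ^ N,
    x ⊳ (y ⊳ (2 ^ N - 1 - i)) = (x ⊳ y) ⊳ (x ⊳ (2 ^ N - 1 - i)) := by
  intro x
  induction x using Nat.strong_induction_on with
  | _ x IHx =>
  intro hx y
  rcases Nat.eq_zero_or_pos x with rfl | hx0
  · intros; rfl
  induction y using Nat.strong_induction_on with
  | _ y IHy =>
  intro hy i hi
  rcases Nat.eq_zero_or_pos y with rfl | hy0
  · rw [op_zero_left, op_zero_right, op_zero_left]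
  have key : ∀ u v, u < 2 ^ N → v < 2 ^ N → (∀ i < 2 ^ N,
    u ⊳ (v ⊳ (2 ^ N - 1 - i)) = (u ⊳ v) ⊳ (u ⊳ (2 ^ N - 1 - i))) → ∀ t < 2 ^ N,
      u ⊳ (v ⊳ t) = (u ⊳ v) ⊳ (u ⊳ t) := by
    intro u v _ _ h t ht
    have := h (2 ^ N - 1 - t) (by omega)
    rwa [show 2 ^ N - 1 - (2 ^ N - 1 - t) = t by omega] at this
  induction i with
  | zero => rw [Nat.sub_zero, op_last hx0 hx, op_last hy0 hy, op_pred hx0 hy0]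
  | succ i ih =>
    have hz : 0 < 2 ^ N - 1 - i := by omega
    have h1 := ih (by omega)
    rw [show 2 ^ N - 1 - (i + 1) = 2 ^ N - 1 - i - 1 by omega]
    generalize 2 ^ N - 1 - i = z at *
    have hxy := op_lt_left y hx0
    have hxz := op_lt_left z hx0
    have hyz := op_lt_left z hy0
    rw [op_pred hy0 hz, op_pred hx0 hz,
      key x (y ⊳ z) hx (by omega) (IHy _ hyz (by omega)) _ (by omega), h1, op_pred hx0 hy0,
      key (x ⊳ y) (x ⊳ z) (by omega) (by omega) (IHx _ hxy (by omega) _ (by omega)) _ (by omega)]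

/-- Left distributivity. -/
theorem op_op_op (x y z : ℕ) : x ⊳ (y ⊳ z) = (x ⊳ y) ⊳ (x ⊳ z) := by
  obtain ⟨N, h1, h2, h3⟩ := exists_lt_two_pow x y z
  have := op_op_op_of_lt N x h1 y h2 (2 ^ N - 1 - z) (by omega)
  rwa [show 2 ^ N - 1 - (2 ^ N - 1 - z) = z by omega] at this

theorem op_modEq_right {M u : ℕ} (h : 2 ^ M ∣ u) (t : ℕ) : u ⊳ t ≡ t [MOD 2 ^ M] :=
  op_modEq ((Nat.modEq_zero_iff_dvd).2 h) rfl

theorem two_pow_op (M t : ℕ) : 2 ^ M ⊳ t = t % 2 ^ M := by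
  rw [← Nat.mod_eq_of_lt (op_lt_left t (show 0 < 2 ^ M by positivity))]
  exact op_modEq_right dvd_rfl t

theorem op_last_eq {N x : ℕ} (hN : x < 2 ^ N) : (x + 1) ⊳ (2 ^ N - 1) = x := by
  rcases lt_or_eq_of_le (Nat.succ_le_of_lt hN) with h | h
  · exact op_last (Nat.succ_pos x) h
  · rw [show x + 1 = 2 ^ N from h, two_pow_op, Nat.mod_eq_of_lt (by omega)]
    omega

/-- Since t % 2^M is 2^M ⊳ t, this is left distributivity. -/
theorem op_mod_right {u M : ℕ} (h : u ⊳ 2 ^ M = 0) (t : ℕ) : u ⊳ (t % 2 ^ M) = u ⊳ t := by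
  rw [← two_pow_op, op_op_op, h, op_zero_left]

theorem op_congr_right {u M t t' : ℕ} (h : u ⊳ 2 ^ M = 0) (ht : t ≡ t' [MOD 2 ^ M]) :
    u ⊳ t = u ⊳ t' := by
  rw [← op_mod_right h, ht, op_mod_right h]

theorem op_lt_of_ne_zero {u t t' : ℕ} (hu : 0 < u) (h : t < t')
    (hne : ∀ s, t < s → s ≤ t' → u ⊳ s ≠ 0) : u ⊳ t < u ⊳ t' := by
  induction t', h using Nat.le_induction with
  | base =>
    have := op_pred hu (Nat.succ_pos t)
    rw [Nat.succ_sub_one] at this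
    rw [this]
    exact op_lt_left _ (Nat.pos_of_ne_zero (hne _ (Nat.lt_succ_self t) le_rfl))
  | succ s hs ih =>
    refine (ih fun r h1 h2 => hne r h1 (by omega)).trans ?_
    have := op_pred hu (Nat.succ_pos s)
    rw [Nat.succ_sub_one] at this
    rw [this]
    exact op_lt_left _ (Nat.pos_of_ne_zero (hne _ (by omega) le_rfl))

theorem le_op_of_ne_zero {u t : ℕ} (hu : 0 < u) (hne : ∀ s, 0 < s → s ≤ t → u ⊳ s ≠ 0) :
    t ≤ u ⊳ t := by
  induction t with
  | zero => exact Nat.zero_le _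
  | succ t ih =>
    have h1 := ih fun s h1 h2 => hne s h1 (by omega)
    have h2 : u ⊳ t < u ⊳ (t + 1) :=
      op_lt_of_ne_zero hu (Nat.lt_succ_self t) fun s h3 h4 => hne s (by omega) h4
    omega

/-! ### Action on critical points. -/

/-- If an elementary embedding is attached to `u`, this says that it maps the `i`-th critical point
to the `j`-th one or beyond. -/
def Sends (u i j : ℕ) : Prop := 2 ^ j ∣ u ⊳ 2 ^ i

theorem Sends.dvd {u i j t : ℕ} (h : Sends u i j) (ht : 2 ^ i ∣ t) : 2 ^ j ∣ u ⊳ t := by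
  obtain ⟨q, -, H⟩ := exists_dvd_op_iff u j
  exact (H t).2 (((H _).1 h).trans ht)

theorem sends_of_dvd {u i j t : ℕ} (h : 2 ^ j ∣ u ⊳ t) (ht : ¬ 2 ^ (i + 1) ∣ t) :
    Sends u i j := by
  obtain ⟨q, -, H⟩ := exists_dvd_op_iff u j
  refine (H _).2 (pow_dvd_pow 2 ?_)
  by_contra hc
  exact ht ((pow_dvd_pow 2 (by omega)).trans ((H t).1 h))

theorem Sends.mono {u i j i' j' : ℕ} (h : Sends u i j) (hi : i ≤ i') (hj : j' ≤ j) :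
    Sends u i' j' :=
  (pow_dvd_pow 2 hj).trans (h.dvd (pow_dvd_pow 2 hi))

theorem sends_congr {u u' i j : ℕ} (h : u ≡ u' [MOD 2 ^ j]) : Sends u i j ↔ Sends u' i j :=
  (op_modEq h rfl).dvd_iff dvd_rfl

theorem sends_iff_eq_zero {u i j : ℕ} (h0 : 0 < u) (h : u ≤ 2 ^ j) : Sends u i j ↔ u ⊳ 2 ^ i = 0 := by
  refine ⟨fun H => Nat.eq_zero_of_dvd_of_lt H ((op_lt_left _ h0).trans_le h), fun H => ?_⟩
  rw [Sends, H]
  exact dvd_zero _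

/-- Otherwise the row of the residue v has no zero strictly between 0 and 2^(m+1), so it increases
strictly and reaches 2^(m+1) - 1, although its entries are below v. -/
theorem sends_succ_of_not_dvd {u m : ℕ} (h : ¬ 2 ^ (m + 1) ∣ u) : Sends u m (m + 1) := by
  rw [← sends_congr (Nat.mod_modEq u _)]
  have hp : 0 < 2 ^ (m + 1) := by positivity
  have hl := Nat.mod_lt u hp
  rw [Nat.dvd_iff_mod_eq_zero] at h
  set v := u % 2 ^ (m + 1)
  have hv : 0 < v := Nat.pos_of_ne_zero h
  obtain ⟨q, hq, H⟩ := exists_dvd_op_iff v (m + 1)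
  refine (H _).2 (pow_dvd_pow 2 ?_)
  by_contra hc
  obtain rfl : q = m + 1 := by omega
  have h1 : 2 ^ (m + 1) - 1 ≤ v ⊳ (2 ^ (m + 1) - 1) := by
    refine le_op_of_ne_zero hv fun s h1 h2 h3 => ?_
    have := Nat.le_of_dvd h1 ((H s).1 (h3 ▸ dvd_zero _))
    omega
  have := op_lt_left (2 ^ (m + 1) - 1) hv
  omega

theorem op_two_pow_eq_zero {w l : ℕ} (h0 : 0 < w) (h : w < 2 ^ (l + 1)) : w ⊳ 2 ^ l = 0 :=
  (sends_iff_eq_zero h0 h.le).1 (sends_succ_of_not_dvd fun hd => absurd (Nat.le_of_dvd h0 hd) (by omega))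

/-- Otherwise v ⊳ 2^i < v ⊳ 2^(i+1) would be two distinct nonzero multiples of 2^j below 2^(j+1). -/
theorem Sends.succ {u i j : ℕ} (h : Sends u i j) : Sends u (i + 1) (j + 1) := by
  by_cases hd : 2 ^ (j + 1) ∣ u
  · have h1 : 2 ^ j ∣ 2 ^ i := by
      have h2 := op_modEq_right ((pow_dvd_pow 2 (Nat.le_succ j)).trans hd) (2 ^ i)
      exact (h2.dvd_iff dvd_rfl).1 h
    have h3 := op_modEq_right hd (2 ^ (i + 1))
    refine (h3.dvd_iff dvd_rfl).2 ?_
    exact pow_dvd_pow 2 (Nat.succ_le_succ ((Nat.pow_dvd_pow_iff_le_right (by decide)).1 h1))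
  rw [← sends_congr (Nat.mod_modEq u _)]
  rw [← sends_congr ((Nat.mod_modEq u (2 ^ (j + 1))).of_dvd (pow_dvd_pow 2 (Nat.le_succ j)))] at h
  have hl := Nat.mod_lt u (show 0 < 2 ^ (j + 1) by positivity)
  rw [Nat.dvd_iff_mod_eq_zero] at hd
  set v := u % 2 ^ (j + 1)
  have hv : 0 < v := Nat.pos_of_ne_zero hd
  obtain ⟨q, hq, H⟩ := exists_dvd_op_iff v (j + 1)
  refine (H _).2 (pow_dvd_pow 2 ?_)
  by_contra hc
  have hq2 : 2 ^ (i + 1) < 2 ^ q := Nat.pow_lt_pow_right (by decide) (by omega)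
  have hi : 2 ^ (i + 1) = 2 * 2 ^ i := by ring
  have hj : 2 ^ (j + 1) = 2 * 2 ^ j := by ring
  have hp : 0 < 2 ^ i := by positivity
  have hne : ∀ s, 0 < s → s < 2 ^ q → v ⊳ s ≠ 0 := fun s h1 h2 h3 => by
    have := Nat.le_of_dvd h1 ((H s).1 (h3 ▸ dvd_zero _))
    omega
  have h1 : v ⊳ 2 ^ i < v ⊳ 2 ^ (i + 1) :=
    op_lt_of_ne_zero hv (by omega) fun s h2 h3 => hne s (by omega) (by omega)
  have h2 := op_lt_left (2 ^ (i + 1)) hv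
  have h3 := h.dvd (pow_dvd_pow 2 (Nat.le_succ i))
  have h4 := hne (2 ^ i) hp (by omega)
  obtain ⟨a, ha⟩ := h
  obtain ⟨b, hb⟩ := h3
  rw [ha] at h1 h4
  rw [Nat.succ_eq_add_one] at hb
  rw [hb] at h1 h2
  have ha1 : a < b := lt_of_mul_lt_mul_left h1 (Nat.zero_le _)
  have hb1 : b < 2 := by
    refine lt_of_mul_lt_mul_left (a := 2 ^ j) ?_ (Nat.zero_le _)
    omega
  obtain rfl : a = 0 := by omega
  exact h4 (Nat.mul_zero _)

theorem Sends.add {u i j : ℕ} (h : Sends u i j) (d : ℕ) : Sends u (i + d) (j + d) := by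
  induction d with
  | zero => exact h
  | succ d ih => exact ih.succ

/-! ### Left powers and composition. -/

/-- A map which respects the products with `u - 1` transports the row of `u`. -/
theorem op_of_left_powers {φ : ℕ → ℕ} {u : ℕ} (hu : 0 < u)
    (h : ∀ v < u, φ v ⊳ φ (u - 1) = φ (v ⊳ (u - 1))) (j : ℕ) :
    (φ (u - 1) + 1) ⊳ j = φ (u ⊳ j) := by
  obtain ⟨N, h1, h2, h3⟩ := exists_lt_two_pow (φ (u - 1) + 1) u j
  suffices H : ∀ i < 2 ^ N, (φ (u - 1) + 1) ⊳ (2 ^ N - 1 - i) = φ (u ⊳ (2 ^ N - 1 - i)) by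
    have := H (2 ^ N - 1 - j) (by omega)
    rwa [show 2 ^ N - 1 - (2 ^ N - 1 - j) = j by omega] at this
  intro i hi
  induction i with
  | zero => rw [Nat.sub_zero, op_last (Nat.succ_pos _) h1, op_last hu h2]; rfl
  | succ i ih =>
    rw [show 2 ^ N - 1 - (i + 1) = 2 ^ N - 1 - i - 1 by omega, op_pred (Nat.succ_pos _) (by omega),
      op_pred hu (by omega), ih (by omega), Nat.succ_sub_one, h _ (op_lt_left _ hu)]

/-- The number a ⊳ (b - 1) + 1 plays the role of the composition of a and b. -/
theorem op_comp (a : ℕ) {b : ℕ} (hb : 0 < b) (t : ℕ) : (a ⊳ (b - 1) + 1) ⊳ t = a ⊳ (b ⊳ t) :=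
  op_of_left_powers (φ := fun v => a ⊳ v) hb (fun _ _ => (op_op_op _ _ _).symm) t

/-! ### Separating low and high binary digits. -/

/-- Every embedding with critical point below the `M`-th one sends the latter to the `M + l`-th one
or beyond. -/
def Shifts (M l : ℕ) : Prop := ∀ u, ¬ 2 ^ M ∣ u → Sends u M (M + l)

theorem Shifts.op_eq_zero {M l u : ℕ} (hK : Shifts M l) (h : ¬ 2 ^ M ∣ u) (hu : u ≤ 2 ^ (M + l)) :
    u ⊳ 2 ^ M = 0 :=
  (sends_iff_eq_zero (Nat.pos_of_ne_zero fun h0 => h (by rw [h0]; exact dvd_zero _)) hu).1 (hK u h)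

theorem not_dvd_add {d a s : ℕ} (ha : d ∣ a) (h0 : 0 < s) (hs : s < d) : ¬ d ∣ a + s := fun h =>
  absurd (Nat.le_of_dvd h0 ((Nat.dvd_add_right ha).1 h)) (by omega)

theorem add_le_of_dvd {d a b : ℕ} (ha : d ∣ a) (hb : d ∣ b) (h : a < b) : a + d ≤ b := by
  have := Nat.le_of_dvd (by omega) (Nat.dvd_sub hb ha)
  omega

/-- Only the last block is assumed. Descending on v, write z (v - 1) + s as z v ⊳ (z (2^l - 1) + s)
and distribute z w over it; the induction on w then applies to w ⊳ v < w. -/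
theorem op_spread {z : ℕ → ℕ} {M l : ℕ} (h0 : z 0 = 0)
    (h : ∀ w, 0 < w → w < 2 ^ l → ∀ s < 2 ^ M, z w ⊳ (z (2 ^ l - 1) + s) = z (w - 1) + s) :
    ∀ w < 2 ^ l, ∀ v < 2 ^ l, ∀ s < 2 ^ M, z w ⊳ (z v + s) = z (w ⊳ v) + s := by
  intro w
  induction w using Nat.strong_induction_on with
  | _ w IH =>
  intro hw
  rcases Nat.eq_zero_or_pos w with rfl | hw0
  · intros; rw [h0]; rfl
  suffices H : ∀ i < 2 ^ l, ∀ s < 2 ^ M,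
      z w ⊳ (z (2 ^ l - 1 - i) + s) = z (w ⊳ (2 ^ l - 1 - i)) + s by
    intro v hv
    have := H (2 ^ l - 1 - v) (by omega)
    rwa [show 2 ^ l - 1 - (2 ^ l - 1 - v) = v by omega] at this
  intro i hi
  induction i with
  | zero =>
    intro s hs
    rw [Nat.sub_zero, op_last hw0 hw, h w hw0 hw s hs]
  | succ i ih =>
    intro s hs
    have hv : 0 < 2 ^ l - 1 - i := by omega
    have hv' : 2 ^ l - 1 - i < 2 ^ l := by omega
    have ih := ih (by omega) 0 (by positivity)
    rw [show 2 ^ l - 1 - (i + 1) = 2 ^ l - 1 - i - 1 by omega]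
    generalize 2 ^ l - 1 - i = v at *
    have := op_lt_left v hw0
    rw [← h v hv hv' s hs, op_op_op, ← Nat.add_zero (z v), ih, Nat.add_zero, h w hw0 hw s hs,
      IH _ this (by omega) _ (by omega) s hs, op_pred hw0 hv]

/-- Each step to the left gives (y - i) ⊳ (y - 1). By periodicity y - 1 may be replaced by 2^N - 1,
where the entry is the predecessor. -/
theorem op_two_pow_sub {N M y : ℕ} (hMN : M ≤ N) (h0 : 0 < y) (hy : y < 2 ^ N) (hd : 2 ^ M ∣ y)
    (h : ∀ s, 0 < s → s < 2 ^ M → (y - s) ⊳ 2 ^ M = 0) {i : ℕ} (hi0 : 0 < i) (hi : i ≤ 2 ^ M) :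
    y ⊳ (2 ^ N - i) = y - i := by
  have hyM := Nat.le_of_dvd h0 hd
  induction i, hi0 using Nat.le_induction with
  | base => exact op_last h0 hy
  | succ i hi0 ih =>
    have ht : y - 1 ≡ 2 ^ N - 1 [MOD 2 ^ M] := by
      refine Nat.ModEq.add_right_cancel' 1 ?_
      rw [Nat.sub_add_cancel h0, Nat.sub_add_cancel (by omega)]
      exact ((Nat.modEq_zero_iff_dvd).2 hd).trans
        ((Nat.modEq_zero_iff_dvd).2 (pow_dvd_pow 2 hMN)).symm
    rw [show 2 ^ N - (i + 1) = 2 ^ N - i - 1 by omega, op_pred h0 (by omega), ih (by omega),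
      op_congr_right (h i hi0 (by omega)) ht, op_last (by omega) (by omega)]
    omega

theorem Shifts.mul_op {M l : ℕ} (hK : Shifts M l) :
    ∀ w < 2 ^ l, ∀ v < 2 ^ l, ∀ s < 2 ^ M,
      (2 ^ M * w) ⊳ (2 ^ M * v + s) = 2 ^ M * (w ⊳ v) + s := by
  refine op_spread (z := fun w => 2 ^ M * w) (Nat.mul_zero _) fun w hw0 hw s hs => ?_
  have hp : 0 < 2 ^ M := by positivity
  have h1 : 2 ^ M * w < 2 ^ (M + l) := by rw [pow_add]; exact Nat.mul_lt_mul_of_pos_left hw hp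
  have h2 : 2 ^ M ≤ 2 ^ M * w := Nat.le_mul_of_pos_right _ hw0
  have h3 : 2 ^ M * (w - 1) = 2 ^ M * w - 2 ^ M := by rw [Nat.mul_sub, Nat.mul_one]
  have h4 : 2 ^ M * (2 ^ l - 1) = 2 ^ (M + l) - 2 ^ M := by
    rw [Nat.mul_sub, Nat.mul_one, pow_add]
  have key := op_two_pow_sub (Nat.le_add_right M l) (by positivity) h1 (Dvd.intro _ rfl)
    (fun s hs0 hs => hK.op_eq_zero (fun hd => ?_) (by omega)) (i := 2 ^ M - s) (by omega) (by omega)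
  · rw [h3, h4, show 2 ^ (M + l) - 2 ^ M + s = 2 ^ (M + l) - (2 ^ M - s) by omega, key]
    omega
  · have := (Nat.dvd_sub_iff_right (by omega) (Dvd.intro w rfl)).1 hd
    exact absurd (Nat.le_of_dvd hs0 this) (by omega)

/-- The map which replaces the digits of `u` above the lowest `M` ones as prescribed by `z`. -/
def blockMap (z : ℕ → ℕ) (M u : ℕ) : ℕ := z (u / 2 ^ M) + u % 2 ^ M

theorem blockMap_mul_add (z : ℕ → ℕ) {M s : ℕ} (w : ℕ) (hs : s < 2 ^ M) :
    blockMap z M (2 ^ M * w + s) = z w + s := by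
  rw [blockMap, Nat.mul_add_div (by positivity), Nat.div_eq_of_lt hs, Nat.mul_add_mod,
    Nat.mod_eq_of_lt hs, Nat.add_zero]

theorem blockMap_zero {z : ℕ → ℕ} (h0 : z 0 = 0) (M : ℕ) : blockMap z M 0 = 0 := by
  simp [blockMap, h0]

theorem Shifts.blockMap_op {z : ℕ → ℕ} {M l : ℕ} (hK : Shifts M l) (h0 : z 0 = 0)
    (hd : ∀ w, 2 ^ M ∣ z w)
    (h : ∀ w, 0 < w → w < 2 ^ l → ∀ s < 2 ^ M, z w ⊳ (z (2 ^ l - 1) + s) = z (w - 1) + s) :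
    ∀ u < 2 ^ (M + l), ∀ v < 2 ^ (M + l),
      blockMap z M u ⊳ blockMap z M v = blockMap z M (u ⊳ v) := by
  have hp : 0 < 2 ^ M := by positivity
  intro u
  induction u using Nat.strong_induction_on with
  | _ u IH =>
  intro hu v hv
  have hdiv : ∀ t < 2 ^ (M + l), t / 2 ^ M < 2 ^ l := fun t ht =>
    Nat.div_lt_of_lt_mul (by rwa [← pow_add])
  rcases Nat.eq_zero_or_pos (u % 2 ^ M) with hs | hs
  · obtain ⟨w, rfl⟩ := Nat.dvd_of_mod_eq_zero hs
    have hw := hdiv _ hu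
    rw [Nat.mul_div_cancel_left _ hp] at hw
    have hv0 := Nat.mod_lt v hp
    have h1 := blockMap_mul_add z w hp
    rw [Nat.add_zero, Nat.add_zero] at h1
    rw [h1, blockMap, op_spread h0 h w hw _ (hdiv v hv) _ hv0]
    nth_rewrite 3 [← Nat.div_add_mod v (2 ^ M)]
    rw [hK.mul_op w hw _ (hdiv v hv) _ hv0, blockMap_mul_add _ _ hv0]
  · have hu0 : 0 < u := Nat.pos_of_ne_zero fun hu0 => by simp [hu0] at hs
    have hnd : ¬ 2 ^ M ∣ u := fun hd => by rw [Nat.dvd_iff_mod_eq_zero] at hd; omega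
    have hrow : ∀ j, blockMap z M u ⊳ j = blockMap z M (u ⊳ j) := by
      have h1 : blockMap z M (u - 1) + 1 = blockMap z M u := by
        have hl := Nat.mod_lt u hp
        have h2 := Nat.div_add_mod u (2 ^ M)
        rw [show u - 1 = 2 ^ M * (u / 2 ^ M) + (u % 2 ^ M - 1) by omega,
          blockMap_mul_add _ _ (by omega), blockMap]
        omega
      rw [← h1]
      exact op_of_left_powers hu0 fun v hv => IH v hv (by omega) _ (by omega)
    have hz : blockMap z M u ⊳ 2 ^ M = 0 := by
      rw [hrow, hK.op_eq_zero hnd hu.le, blockMap_zero h0]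
    rw [← hrow]
    -- The image of u has a 2^M-periodic row, and the map keeps the lowest M digits of v.
    refine op_congr_right hz ?_
    have h2 : blockMap z M v ≡ 0 + v % 2 ^ M [MOD 2 ^ M] :=
      Nat.ModEq.add_right _ ((Nat.modEq_zero_iff_dvd).2 (hd _))
    rw [Nat.zero_add] at h2
    exact h2.trans (Nat.mod_modEq _ _)

theorem one_op (w : ℕ) : 1 ⊳ w = 0 := by
  have := two_pow_op 0 w
  rwa [pow_zero, Nat.mod_one] at this

theorem dvd_succ_op {M x : ℕ} (hx : 2 ^ M ∣ x) (w : ℕ) : 2 ^ M ∣ (x + 1) ⊳ w := by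
  have h : x + 1 ≡ 0 + 1 [MOD 2 ^ M] := Nat.ModEq.add_right 1 ((Nat.modEq_zero_iff_dvd).2 hx)
  have h2 := op_modEq h (Nat.ModEq.refl w)
  rw [Nat.zero_add, one_op] at h2
  exact (Nat.modEq_zero_iff_dvd).1 h2

theorem succ_op_last {x l : ℕ} (h : (x + 1) ⊳ 2 ^ l = 0) : (x + 1) ⊳ (2 ^ l - 1) = x := by
  obtain ⟨N, h1, h2, -⟩ := exists_lt_two_pow (x + 1) (2 ^ l) 0
  have h3 : 2 ^ l - 1 ≡ 2 ^ N - 1 [MOD 2 ^ l] := by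
    have h4 : 2 ^ l ∣ 2 ^ N := pow_dvd_pow 2 ((Nat.pow_lt_pow_iff_right (by decide)).1 h2).le
    have h5 : 0 < 2 ^ l := by positivity
    refine Nat.ModEq.add_right_cancel' 1 ?_
    rw [Nat.sub_add_cancel h5, Nat.sub_add_cancel (by omega)]
    exact ((Nat.modEq_zero_iff_dvd).2 dvd_rfl).trans ((Nat.modEq_zero_iff_dvd).2 h4).symm
  rw [op_congr_right h h3, op_last (Nat.succ_pos x) h1, Nat.succ_sub_one]

/-! ### Rows of x + 1, x + s and x + 2^M. -/

/-- The row of `x + 1` respects the addition of small numbers. -/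
def RowAdds (M l x : ℕ) : Prop := ∀ w, 0 < w → w < 2 ^ l → ∀ s < 2 ^ M,
  ((x + 1) ⊳ w) ⊳ (x + s) = (x + 1) ⊳ (w - 1) + s

theorem Shifts.blockMap_row {M l x : ℕ} (hK : Shifts M l) (hx : 2 ^ M ∣ x)
    (h : (x + 1) ⊳ 2 ^ l = 0) (hG : RowAdds M l x) {u : ℕ} (hu0 : 0 < u) (hu : u ≤ 2 ^ (M + l))
    (j : ℕ) : (blockMap (fun w => (x + 1) ⊳ w) M (u - 1) + 1) ⊳ j =
      blockMap (fun w => (x + 1) ⊳ w) M (u ⊳ j) := by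
  refine op_of_left_powers (φ := blockMap (fun w => (x + 1) ⊳ w) M) hu0 (fun v hv => ?_) j
  refine hK.blockMap_op (op_zero_right _) (dvd_succ_op hx) ?_ v (by omega) _ (by omega)
  rw [succ_op_last h]
  exact hG

/-- The row of x + s is the image of the row of 2^M (2^l - 1) + s. `RowAdds` stays a hypothesis
because the induction in `Shifts.rowAdds` uses this at smaller numbers. -/
theorem Shifts.add_op_eq_zero_aux {M l x : ℕ} (hK : Shifts M l) (hx : 2 ^ M ∣ x)
    (h : (x + 1) ⊳ 2 ^ l = 0) (hG : RowAdds M l x) {s : ℕ} (hs0 : 0 < s) (hs : s < 2 ^ M) :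
    (x + s) ⊳ 2 ^ M = 0 := by
  have hp : 0 < 2 ^ l := by positivity
  have hu : 2 ^ M * (2 ^ l - 1) + s < 2 ^ (M + l) := by
    have h1 : 2 ^ M ≤ 2 ^ M * 2 ^ l := Nat.le_mul_of_pos_right _ hp
    rw [Nat.mul_sub, Nat.mul_one, pow_add]
    omega
  have h2 := hK.blockMap_row hx h hG (u := 2 ^ M * (2 ^ l - 1) + s) (by omega) hu.le (2 ^ M)
  rw [hK.op_eq_zero (not_dvd_add (Dvd.intro _ rfl) hs0 hs) hu.le,
    blockMap_zero (op_zero_right _), Nat.add_sub_assoc hs0, blockMap_mul_add _ _ (by omega),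
    succ_op_last h, Nat.add_assoc, Nat.sub_add_cancel hs0] at h2
  exact h2

theorem eq_or_eq_add_of_modEq {n a R : ℕ} (h : n ≡ a [MOD R]) (ha : a < R) (hn : n < 2 * R) :
    n = a ∨ n = R + a := by
  unfold Nat.ModEq at h
  rw [Nat.mod_eq_of_lt ha] at h
  rcases Nat.lt_or_ge n R with h1 | h1
  · rw [Nat.mod_eq_of_lt h1] at h
    exact Or.inl h
  · rw [Nat.mod_eq_sub_mod h1, Nat.mod_eq_of_lt (by omega)] at h
    omega

/-- Induction on x, removing its leading digit 2^r. Modulo 2^r the claim is the one for x', so both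
sides are known up to a summand 2^r, and only the two mixed cases have to be excluded. -/
theorem Shifts.rowAdds {M l : ℕ} (hK : Shifts M l) (x : ℕ) (hx : 2 ^ M ∣ x)
    (h : (x + 1) ⊳ 2 ^ l = 0) : RowAdds M l x := by
  induction x using Nat.strong_induction_on with
  | _ x IH =>
  intro w hw0 hw s
  induction s with
  | zero =>
    intro _
    have := op_pred (Nat.succ_pos x) hw0
    rw [Nat.succ_sub_one] at this
    exact this.symm
  | succ s ih =>
  intro hs
  have ih := ih (by omega)
  rcases Nat.eq_zero_or_pos x with rfl | hx0
  · rw [Nat.zero_add, one_op, one_op, op_zero_left]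
  have hxM := Nat.le_of_dvd hx0 hx
  obtain ⟨r, hr1, hr2⟩ : ∃ r, 2 ^ r ≤ x ∧ x < 2 ^ (r + 1) :=
    ⟨Nat.log 2 x, Nat.pow_log_le_self 2 hx0.ne', Nat.lt_pow_succ_log_self (by decide) x⟩
  have hMr : M ≤ r :=
    Nat.lt_succ_iff.1 ((Nat.pow_lt_pow_iff_right (by decide)).1 (hxM.trans_lt hr2))
  have hMr' : 2 ^ M ∣ 2 ^ r := pow_dvd_pow 2 hMr
  have hr3 : 2 ^ (r + 1) = 2 * 2 ^ r := by ring
  have hrp : 0 < 2 ^ r := by positivity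
  obtain ⟨x', rfl⟩ : ∃ x', x = 2 ^ r + x' := ⟨x - 2 ^ r, by omega⟩
  have hx' : 2 ^ M ∣ x' := (Nat.dvd_add_right hMr').1 hx
  have hmod : ∀ t, 2 ^ r + t ≡ t [MOD 2 ^ r] := fun t => Nat.add_modEq_left
  have hmodx : ∀ t, (2 ^ r + x' + 1) ⊳ t ≡ (x' + 1) ⊳ t [MOD 2 ^ r] := fun t =>
    op_modEq ((hmod x').add_right 1) rfl
  have h' : (x' + 1) ⊳ 2 ^ l = 0 :=
    (sends_iff_eq_zero (j := r) (Nat.succ_pos _) (by omega)).1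
      ((hmodx _).dvd_iff dvd_rfl |>.1 (h ▸ dvd_zero _))
  have hval' := IH x' (by omega) hx' h' w hw0 hw (s + 1) hs
  have hval : ((2 ^ r + x' + 1) ⊳ w) ⊳ (2 ^ r + x' + (s + 1)) ≡
      (x' + 1) ⊳ (w - 1) + (s + 1) [MOD 2 ^ r] := by
    rw [← hval']
    exact op_modEq (hmodx w) ((hmod x').add_right _)
  have hA := op_lt_left (w - 1) (Nat.succ_pos x')
  have hA' := dvd_succ_op hx' (w - 1)
  rw [Nat.succ_eq_add_one] at hA
  have hA2 := add_le_of_dvd hA' hMr' (by omega)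
  have hSlt := op_lt_left (w - 1) (Nat.succ_pos (2 ^ r + x'))
  have hS := eq_or_eq_add_of_modEq (hmodx (w - 1)) (by omega)
    (lt_of_lt_of_le hSlt (by omega))
  have hcomp := op_comp (2 ^ r + x' + 1) hw0
  have hz : (2 ^ r + x' + 1) ⊳ w < 2 ^ r + x' + 1 := op_lt_left w (Nat.succ_pos _)
  have hzd := dvd_succ_op hx w
  rcases Nat.eq_zero_or_pos ((2 ^ r + x' + 1) ⊳ w) with hz0 | hz0
  · have h0 := op_pred (Nat.succ_pos (2 ^ r + x')) hw0
    rw [Nat.succ_eq_add_one, hz0, op_zero_left] at h0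
    rw [hz0, op_zero_left, h0]
    rfl
  have hpred := op_pred hz0 (show 0 < 2 ^ r + x' + (s + 1) by omega)
  rw [← Nat.add_assoc, Nat.add_sub_cancel, ih, Nat.add_assoc (2 ^ r + x')] at hpred
  have hvallt := op_lt_left (2 ^ r + x' + (s + 1)) hz0
  have hval2 := eq_or_eq_add_of_modEq hval (by omega) (by omega)
  generalize (x' + 1) ⊳ (w - 1) = A at *
  generalize (2 ^ r + x' + 1) ⊳ (w - 1) = S at *
  generalize (2 ^ r + x' + 1) ⊳ w = z at *
  generalize z ⊳ (2 ^ r + x' + (s + 1)) = val at *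
  rcases hS with rfl | rfl <;> rcases hval2 with rfl | rfl
  · rfl
  -- The left side would be 2^r + S + (s + 1). As 2^r + S is below x and inherits the hypotheses
  -- through `op_comp` and `Sends.succ`, this number has a 2^M-periodic row; its entry at z - 1 is
  -- then its predecessor, contradicting `hpred`.
  · exfalso
    obtain ⟨l, rfl⟩ : ∃ l', l = l' + 1 :=
      Nat.exists_eq_succ_of_ne_zero fun hl => by rw [hl] at hw; omega
    have hy1 : Sends (S + 1) l r := by
      rw [Sends, hcomp, op_two_pow_eq_zero hw0 hw, op_zero_right]
      exact dvd_zero _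
    have hy2 : (2 ^ r + S + 1) ⊳ 2 ^ (l + 1) = 0 :=
      (sends_iff_eq_zero (Nat.succ_pos _) (by omega)).1
        (((sends_congr ((hmod S).add_right 1)).2 hy1).succ)
    have hyd : 2 ^ M ∣ 2 ^ r + S := dvd_add hMr' hA'
    have hE := hK.add_op_eq_zero_aux hyd hy2 (IH _ (by omega) hyd hy2) (Nat.succ_pos s) hs
    have hzM := Nat.le_of_dvd hz0 hzd
    have ht : z - 1 ≡ 2 ^ (r + 1) - 1 [MOD 2 ^ M] := by
      refine Nat.ModEq.add_right_cancel' 1 ?_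
      rw [Nat.sub_add_cancel hz0, Nat.sub_add_cancel (by omega)]
      exact ((Nat.modEq_zero_iff_dvd).2 hzd).trans
        ((Nat.modEq_zero_iff_dvd).2 (hMr'.trans (pow_dvd_pow 2 (Nat.le_succ r)))).symm
    rw [← Nat.add_assoc (2 ^ r) S (s + 1)] at *
    rw [op_congr_right hE ht, op_last (by omega) (by omega)] at hpred
    omega
  · exfalso
    have := op_lt_left (z - 1) (show 0 < A + (s + 1) by omega)
    omega
  · rw [Nat.add_assoc]

theorem Shifts.add_op_eq_zero {M l x : ℕ} (hK : Shifts M l) (hx : 2 ^ M ∣ x)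
    (h : (x + 1) ⊳ 2 ^ l = 0) {s : ℕ} (hs0 : 0 < s) (hs : s < 2 ^ M) : (x + s) ⊳ 2 ^ M = 0 :=
  hK.add_op_eq_zero_aux hx h (hK.rowAdds x hx h) hs0 hs

theorem Shifts.add_two_pow_op {M l x : ℕ} (hK : Shifts M l) (hx : 2 ^ M ∣ x)
    (h : (x + 1) ⊳ 2 ^ l = 0) {w s : ℕ} (hs : s < 2 ^ M) :
    (x + 2 ^ M) ⊳ (2 ^ M * w + s) = (x + 1) ⊳ w + s := by
  have hp : 0 < 2 ^ M := by positivity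
  have hp' : 0 < 2 ^ l := by positivity
  -- The row of 2^(M+l) is reduction modulo 2^(M+l); its image is the row of x + 2^M.
  have h1 := hK.blockMap_row hx h (hK.rowAdds x hx h) (u := 2 ^ (M + l)) (by positivity) le_rfl
    (2 ^ M * w + s)
  have h2 : 2 ^ (M + l) - 1 = 2 ^ M * (2 ^ l - 1) + (2 ^ M - 1) := by
    have : 2 ^ M ≤ 2 ^ M * 2 ^ l := Nat.le_mul_of_pos_right _ hp'
    rw [Nat.mul_sub, Nat.mul_one, pow_add]
    omega
  rw [two_pow_op, h2, blockMap_mul_add _ _ (by omega), succ_op_last h, Nat.add_assoc,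
    Nat.sub_add_cancel hp, pow_add, Nat.mod_mul, Nat.mul_add_mod, Nat.mod_eq_of_lt hs,
    Nat.mul_add_div hp, Nat.div_eq_of_lt hs, Nat.add_zero, Nat.add_comm s,
    blockMap_mul_add _ _ hs, op_mod_right h] at h1
  exact h1

/-! ### `Shifts` at multiples of a power of two. -/

/-- For c = 2^p (2^(l+1) - 1) + 1 the end of the row descends in steps of 2^p, so 2^(p+l) occurs at
a position divisible by 2^l. -/
theorem Shifts.exists_shift {p l : ℕ} (hl : 0 < l) (hK : Shifts p l) :
    ∃ c, Sends c 0 p ∧ ¬ Sends c l (p + l + 1) := by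
  have hp : 0 < 2 ^ p := by positivity
  have hlp : 0 < 2 ^ l := by positivity
  have hl2 : 2 ^ (l + 1) = 2 * 2 ^ l := by ring
  have hN : 2 ^ (p + l + 1) = 2 ^ p * 2 ^ (l + 1) := by rw [← pow_add, Nat.add_assoc]
  have hc : 2 ^ p * (2 ^ (l + 1) - 1) = 2 ^ (p + l + 1) - 2 ^ p := by
    rw [Nat.mul_sub, Nat.mul_one, hN]
  have hpN : 2 ^ p ≤ 2 ^ (p + l + 1) := Nat.pow_le_pow_right (by decide) (by omega)
  have hz : ∀ z', 0 < z' → z' < 2 ^ l → (2 ^ p * (2 ^ l + z' - 1) + 1) ⊳ 2 ^ l = 0 := by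
    intro z' h0 h1
    obtain ⟨l, rfl⟩ := Nat.exists_eq_succ_of_ne_zero hl.ne'
    have h2 : (2 ^ p * (z' - 1) + 1) ⊳ 2 ^ l = 2 ^ p * (z' ⊳ 2 ^ l) :=
      op_of_left_powers (φ := fun v => 2 ^ p * v) h0 (fun v hv => by
        have := hK.mul_op v (by omega) (z' - 1) (by omega) 0 hp
        simpa using this) _
    rw [op_two_pow_eq_zero h0 h1, Nat.mul_zero] at h2
    have h3 : Sends (2 ^ p * (z' - 1) + 1) l (p + l.succ) := by
      rw [Sends, h2]
      exact dvd_zero _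
    have h4 : 2 ^ p * (2 ^ l.succ + z' - 1) + 1 ≡ 2 ^ p * (z' - 1) + 1 [MOD 2 ^ (p + l.succ)] := by
      rw [Nat.add_sub_assoc h0, Nat.mul_add, ← pow_add, Nat.add_assoc]
      exact Nat.add_modEq_left
    refine (sends_iff_eq_zero (Nat.succ_pos _) ?_).1 ((sends_congr h4).2 h3).succ
    have : 2 ^ p * (2 ^ l.succ + z' - 1) < 2 ^ p * 2 ^ (l.succ + 1) :=
      Nat.mul_lt_mul_of_pos_left (by omega) hp
    omega
  have key : ∀ i < 2 ^ l, (2 ^ p * (2 ^ (l + 1) - 1) + 1) ⊳ (2 ^ (p + l + 1) - 1 - i) =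
      2 ^ p * (2 ^ (l + 1) - 1 - i) := by
    intro i hi
    induction i with
    | zero =>
      rw [Nat.sub_zero, Nat.sub_zero, op_last_eq]
      omega
    | succ i ih =>
      have h5 : 2 ^ l ≤ 2 ^ (p + l + 1) := Nat.pow_le_pow_right (by decide) (by omega)
      rw [show 2 ^ (p + l + 1) - 1 - (i + 1) = 2 ^ (p + l + 1) - 1 - i - 1 by omega,
        op_pred (Nat.succ_pos _) (by omega), ih (by omega), Nat.succ_sub_one, hc]
      have h6 : 2 ^ p * (2 ^ (l + 1) - 1 - i) < 2 ^ (p + l + 1) := by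
        rw [hN]
        exact Nat.mul_lt_mul_of_pos_left (by omega) hp
      have h7 : 2 ^ p * (2 ^ (l + 1) - 1 - (i + 1)) = 2 ^ p * (2 ^ (l + 1) - 1 - i) - 2 ^ p := by
        rw [← Nat.sub_sub, Nat.mul_sub, Nat.mul_one]
      have h8 : 2 ^ p ≤ 2 ^ p * (2 ^ (l + 1) - 1 - i) := Nat.le_mul_of_pos_right _ (by omega)
      rw [h7]
      refine op_two_pow_sub (by omega) (by omega) h6 (Dvd.intro _ rfl) (fun s hs0 hs => ?_) hp le_rfl
      rw [show 2 ^ p * (2 ^ (l + 1) - 1 - i) - s =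
        2 ^ p * (2 ^ (l + 1) - 1 - (i + 1)) + (2 ^ p - s) by omega]
      refine hK.add_op_eq_zero (Dvd.intro _ rfl) ?_ (by omega) (by omega)
      have := hz (2 ^ l - 1 - i) (by omega) (by omega)
      rwa [show 2 ^ l + (2 ^ l - 1 - i) - 1 = 2 ^ (l + 1) - 1 - (i + 1) by omega] at this
  refine ⟨2 ^ p * (2 ^ (l + 1) - 1) + 1, dvd_succ_op (Dvd.intro _ rfl) _, fun h => ?_⟩
  have h1 := key (2 ^ l - 1) (by omega)
  have h5 : 2 ^ l ∣ 2 ^ (p + l + 1) := pow_dvd_pow 2 (by omega)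
  have h6 := Nat.le_of_dvd (by positivity) h5
  rw [show 2 ^ (p + l + 1) - 1 - (2 ^ l - 1) = 2 ^ (p + l + 1) - 2 ^ l by omega,
    show 2 ^ (l + 1) - 1 - (2 ^ l - 1) = 2 ^ l by omega] at h1
  have h7 := h.dvd (Nat.dvd_sub h5 dvd_rfl)
  rw [h1, hN] at h7
  have := Nat.le_of_dvd (by positivity) h7
  have h9 : 2 ^ p * 2 ^ l < 2 ^ p * 2 ^ (l + 1) := Nat.mul_lt_mul_of_pos_left (by omega) hp
  omega

/-- Compare both sides of u ⊳ (v ⊳ 2^a) = (u ⊳ v) ⊳ (u ⊳ 2^a). The same identity gives `op_sends`.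
-/
theorem sends_of_op {u v a b c d : ℕ} (h1 : Sends u a c) (h2 : ¬ Sends v a (b + 1))
    (h3 : Sends (u ⊳ v) c d) : Sends u b d := by
  have h4 := h3.dvd h1
  rw [← op_op_op] at h4
  exact sends_of_dvd h4 h2

theorem op_sends {u v a b c d : ℕ} (h1 : ¬ Sends u a (d + 1)) (h2 : Sends v a b)
    (h3 : Sends u b c) : Sends (u ⊳ v) d c := by
  have h4 := h3.dvd h2
  rw [op_op_op] at h4
  exact sends_of_dvd h4 h1

theorem not_sends_of_dvd {u p : ℕ} (h : 2 ^ (p + 1) ∣ u) : ¬ Sends u p (p + 1) := fun h1 => by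
  have h2 := ((op_modEq_right h (2 ^ p)).dvd_iff dvd_rfl).1 h1
  rw [Nat.pow_dvd_pow_iff_le_right (by decide)] at h2
  omega

theorem exists_exact_pow {u M : ℕ} (h : ¬ 2 ^ M ∣ u) :
    ∃ m < M, 2 ^ m ∣ u ∧ ¬ 2 ^ (m + 1) ∣ u := by
  induction M with
  | zero => exact absurd (one_dvd u) h
  | succ M ih =>
    by_cases h1 : 2 ^ M ∣ u
    · exact ⟨M, Nat.lt_succ_self M, h1, h⟩
    · obtain ⟨m, hm, h2⟩ := ih h1
      exact ⟨m, by omega, h2⟩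

/-- The witness for p > 0 is a conjugate c ⊳ d: d has critical point 0, and c moves the pattern 0,
g, 2g to p, p + g, p + 2g. -/
theorem exists_step {p g : ℕ} (hg : 0 < g) (hgS : Shifts g g) (hp : p = 0 ∨ Shifts p (2 * g)) :
    ∃ v, 2 ^ p ∣ v ∧ ¬ 2 ^ (p + 1) ∣ v ∧ Sends v p (p + g) ∧
      ¬ Sends v (p + g) (p + 2 * g + 1) := by
  obtain ⟨d, hd1, hd2⟩ := hgS.exists_shift hg
  rw [← two_mul] at hd2
  have hd : ¬ 2 ^ (0 + 1) ∣ d := fun h => not_sends_of_dvd h (hd1.mono le_rfl hg)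
  rcases hp with rfl | hp
  · simp only [Nat.zero_add] at hd ⊢
    exact ⟨d, one_dvd d, hd, hd1, hd2⟩
  obtain ⟨c, hc1, hc2⟩ := hp.exists_shift (by omega)
  have hc0 : ¬ Sends c 0 (p + 1) := fun h => hc2 <| by
    have := h.add (2 * g)
    rwa [Nat.zero_add, Nat.add_right_comm] at this
  have hcg := hc1.add g
  rw [Nat.zero_add] at hcg
  exact ⟨c ⊳ d, hc1.dvd (one_dvd d), fun h => hc0 (sends_of_dvd h hd), op_sends hc0 hd1 hcg,
    fun h => hc2 (sends_of_op hcg hd2 h)⟩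

theorem shifts_two_pow (M : ℕ) : ∀ k, 2 ^ k ∣ M → Shifts M (2 ^ k) := by
  induction M using Nat.strong_induction_on with
  | _ M IH =>
  intro k hk
  rcases Nat.eq_zero_or_pos M with rfl | hM
  · exact fun u h => absurd (one_dvd u) h
  have hkM := Nat.le_of_dvd hM hk
  have hpow : ∀ j < k, 2 ^ (j + 1) ≤ 2 ^ k := fun j hj => Nat.pow_le_pow_right (by decide) hj
  have hsucc : ∀ j, 2 ^ (j + 1) = 2 * 2 ^ j := fun j => by ring
  have hpos : ∀ j, 0 < 2 ^ j := fun j => by positivity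
  have hstep : ∀ j < k, ∃ v, 2 ^ (M - 2 ^ (j + 1)) ∣ v ∧ ¬ 2 ^ (M - 2 ^ (j + 1) + 1) ∣ v ∧
      Sends v (M - 2 ^ (j + 1)) (M - 2 ^ j) ∧ ¬ Sends v (M - 2 ^ j) (M + 1) := by
    intro j hj
    have h1 := hpow j hj
    have h2 := hsucc j
    have h3 := hpos j
    have h4 := exists_step (p := M - 2 ^ (j + 1)) h3 (IH _ (by omega) j dvd_rfl)
      (Or.inr (h2 ▸ IH _ (by omega) (j + 1) (Nat.dvd_sub ((pow_dvd_pow 2 hj).trans hk) dvd_rfl)))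
    rwa [show M - 2 ^ (j + 1) + 2 ^ j = M - 2 ^ j by omega,
      show M - 2 ^ (j + 1) + 2 * 2 ^ j = M by omega] at h4
  -- Passing from u to u ⊳ e doubles the gap 2^j: u fixes the critical point M - 2^(j+1) of e, so u
  -- ⊳ e sends it to M. The conclusion returns to u because e sends M - 2^j no further than M. At j
  -- = k, shift both indices by 2^k.
  have C : ∀ i j, j + i = k → ∀ u, (j = k ∨ 2 ^ (M - 2 ^ (j + 1) + 1) ∣ u) →
      Sends u (M - 2 ^ j) M → Sends u M (M + 2 ^ k) := by
    intro i
    induction i with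
    | zero =>
      rintro j rfl u - h
      have := h.add (2 ^ j)
      rw [Nat.add_zero] at hkM
      rwa [Nat.sub_add_cancel hkM] at this
    | succ i ih =>
      intro j hj u hu h
      have hjk : j < k := by omega
      have hu := hu.resolve_left hjk.ne
      obtain ⟨e, he1, he2, he3, he4⟩ := hstep j hjk
      refine sends_of_op h he4 (ih (j + 1) (by omega) _ ?_ (op_sends (not_sends_of_dvd hu) he3 h))
      refine or_iff_not_imp_left.2 fun hne => ?_
      have h1 := hpow (j + 1) (by omega)
      have h2 := hsucc (j + 1)
      have h3 := hpos (j + 1)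
      have h4 := op_modEq_right ((pow_dvd_pow 2 (Nat.le_succ _)).trans hu) e
      exact (pow_dvd_pow 2 (by omega)).trans ((h4.dvd_iff dvd_rfl).2 he1)
  -- Induction on the distance d from the critical point m of u to M.
  suffices D : ∀ d m u, m + d = M → 0 < d → 2 ^ m ∣ u → ¬ 2 ^ (m + 1) ∣ u →
      Sends u M (M + 2 ^ k) by
    intro u hu
    obtain ⟨m, hm, h1, h2⟩ := exists_exact_pow hu
    exact D (M - m) m u (by omega) (by omega) h1 h2
  intro d
  induction d using Nat.strong_induction_on with
  | _ d IHd =>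
  intro m u hd hd0 hu1 hu2
  have hlow : ∀ i, m < i → ¬ 2 ^ i ∣ u := fun i hi h => hu2 ((pow_dvd_pow 2 hi).trans h)
  rcases Nat.lt_or_ge (2 ^ k) d with hdk | hdk
  · have h1 := IH (M - 2 ^ k) (by have := hpos k; omega) k (Nat.dvd_sub hk dvd_rfl) u
      (hlow _ (by omega))
    rw [Nat.sub_add_cancel hkM] at h1
    exact C 0 k rfl u (Or.inl rfl) h1
  rcases Nat.lt_or_ge 1 d with hd1 | hd1
  · obtain ⟨j, hj1, hj2⟩ : ∃ j, 2 ^ j ≤ d - 1 ∧ d - 1 < 2 ^ (j + 1) :=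
      ⟨Nat.log 2 (d - 1), Nat.pow_log_le_self 2 (by omega),
        Nat.lt_pow_succ_log_self (by decide) _⟩
    have hjk : j < k := (Nat.pow_lt_pow_iff_right (a := 2) (by decide)).1 (by omega)
    have h1 := hpow j hjk
    have h3 := hpos j
    have hS := IH (M - 2 ^ j) (by omega) j
      (Nat.dvd_sub ((pow_dvd_pow 2 hjk.le).trans hk) dvd_rfl) u (hlow _ (by omega))
    rw [Nat.sub_add_cancel (by omega)] at hS
    rcases Nat.lt_or_ge d (2 ^ (j + 1)) with hlt | hge
    · exact C (k - j) j (by omega) u (Or.inr ((pow_dvd_pow 2 (by omega)).trans hu1)) hS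
    -- Boundary case: u and e share the critical point m, so `C` fails at j. That of u ⊳ e is
    -- larger: if it is at least M, then u sends m to M and `C` applies at j + 1; if not, the
    -- distance has dropped.
    · obtain ⟨e, he1, he2, he3, he4⟩ := hstep j hjk
      have hm : M - 2 ^ (j + 1) = m := by omega
      rw [hm] at he1 he2 he3
      by_cases hw : 2 ^ M ∣ u ⊳ e
      · refine C (k - (j + 1)) (j + 1) (by omega) u (or_iff_not_imp_left.2 fun hne => ?_) ?_
        · have h4 := hpow (j + 1) (by omega)
          have h5 := hsucc (j + 1)
          exact (pow_dvd_pow 2 (by omega)).trans hu1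
        · rw [hm]
          exact sends_of_dvd hw he2
      · obtain ⟨m', hm', h4, h5⟩ := exists_exact_pow hw
        have h6 : m < m' := by
          by_contra hc
          exact h5 ((pow_dvd_pow 2 (by omega)).trans ((sends_succ_of_not_dvd hu2).dvd he1))
        exact sends_of_op hS he4 (IHd (M - m') (by omega) m' _ (by omega) (by omega) h4 h5)
  · obtain rfl : M = m + 1 := by omega
    refine C k 0 (Nat.zero_add k) u (or_iff_not_imp_left.2 fun hne => ?_) ?_
    · have h1 := hpow 0 (by omega)
      exact (pow_dvd_pow 2 (by omega)).trans hu1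
    · exact sends_succ_of_not_dvd hu2

theorem Shifts.mono {M l l' : ℕ} (hK : Shifts M l) (h : l' ≤ l) : Shifts M l' := fun u hu =>
  (hK u hu).mono le_rfl (by omega)

/-! ### The digit map is a homomorphism. -/

/-- The map which sends `2 ^ n * w + y` with `y < 2 ^ n` to `(x + 1) ⊳ w + 2 ^ p * y`. -/
def digitMap (x p n u : ℕ) : ℕ := (x + 1) ⊳ (u / 2 ^ n) + 2 ^ p * (u % 2 ^ n)

theorem digitMap_mul_add (x p : ℕ) {n y : ℕ} (w : ℕ) (hy : y < 2 ^ n) :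
    digitMap x p n (2 ^ n * w + y) = (x + 1) ⊳ w + 2 ^ p * y := by
  rw [digitMap, Nat.mul_add_div (by positivity), Nat.div_eq_of_lt hy, Nat.mul_add_mod,
    Nat.mod_eq_of_lt hy, Nat.add_zero w]

theorem digitMap_op {x p n l : ℕ} (hn : Shifts n l) (hp : Shifts p n) (hM : Shifts (p + n) l)
    (hx : 2 ^ (p + n) ∣ x) (h : (x + 1) ⊳ 2 ^ l = 0) :
    ∀ u < 2 ^ (n + l), ∀ v < 2 ^ (n + l),
      digitMap x p n u ⊳ digitMap x p n v = digitMap x p n (u ⊳ v) := by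
  have hn0 : 0 < 2 ^ n := by positivity
  have hp0 : 0 < 2 ^ p := by positivity
  intro u
  induction u using Nat.strong_induction_on with
  | _ u IH =>
  intro hu v hv
  have hdiv : ∀ t < 2 ^ (n + l), t / 2 ^ n < 2 ^ l := fun t ht =>
    Nat.div_lt_of_lt_mul (by rwa [← pow_add])
  have hv0 := Nat.mod_lt v hn0
  rcases Nat.eq_zero_or_pos (u % 2 ^ n) with hs | hs
  · obtain ⟨w, rfl⟩ := Nat.dvd_of_mod_eq_zero hs
    have hw := hdiv _ hu
    rw [Nat.mul_div_cancel_left _ hn0] at hw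
    have h1 := digitMap_mul_add x p w hn0
    rw [Nat.add_zero, Nat.mul_zero, Nat.add_zero] at h1
    have hs : 2 ^ p * (v % 2 ^ n) < 2 ^ (p + n) := by
      rw [pow_add]
      exact Nat.mul_lt_mul_of_pos_left hv0 hp0
    have hG := hM.rowAdds x hx h
    have h2 := op_spread (z := fun w => (x + 1) ⊳ w) (op_zero_right _)
      (by rw [succ_op_last h]; exact hG) w hw _ (hdiv v hv) _ hs
    rw [h1, digitMap, h2]
    nth_rewrite 3 [← Nat.div_add_mod v (2 ^ n)]
    rw [hn.mul_op w hw _ (hdiv v hv) _ hv0, digitMap_mul_add _ _ _ hv0]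
  · have hu0 : 0 < u := Nat.pos_of_ne_zero fun hu0 => by simp [hu0] at hs
    have hnd : ¬ 2 ^ n ∣ u := fun hd => by rw [Nat.dvd_iff_mod_eq_zero] at hd; omega
    have huz := hn.op_eq_zero hnd hu.le
    have hrow : ∀ j, (digitMap x p n (u - 1) + 1) ⊳ j = digitMap x p n (u ⊳ j) :=
      op_of_left_powers hu0 fun v hv => IH v hv (by omega) _ (by omega)
    -- With X the image of u - 1, the image of u is X + 2^p, whereas `hrow` describes X + 1.
    -- `Shifts.add_two_pow_op` passes between them at multiples of 2^p.
    have h1 : digitMap x p n (u - 1) + 2 ^ p = digitMap x p n u := by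
      have hl := Nat.mod_lt u hn0
      have h2 := Nat.div_add_mod u (2 ^ n)
      rw [show u - 1 = 2 ^ n * (u / 2 ^ n) + (u % 2 ^ n - 1) by omega,
        digitMap_mul_add _ _ _ (by omega), digitMap, Nat.add_assoc, ← Nat.mul_succ,
        Nat.succ_eq_add_one, Nat.sub_add_cancel hs]
    have hd : ∀ t, 2 ^ p ∣ digitMap x p n t := fun t =>
      dvd_add ((pow_dvd_pow 2 (Nat.le_add_right p n)).trans (dvd_succ_op hx _)) (Dvd.intro _ rfl)
    have hz : (digitMap x p n (u - 1) + 1) ⊳ 2 ^ n = 0 := by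
      rw [hrow, huz]
      simp [digitMap, op_zero_right]
    obtain ⟨c, hc⟩ := dvd_succ_op hx (v / 2 ^ n)
    have hv1 : digitMap x p n v = 2 ^ p * (2 ^ n * c + v % 2 ^ n) + 0 := by
      rw [digitMap, hc, pow_add]
      ring
    rw [hv1, ← h1, hp.add_two_pow_op (hd _) hz hp0, hrow, Nat.add_zero]
    congr 1
    refine op_congr_right huz ?_
    exact (Nat.mul_add_mod _ _ _).trans (Nat.mod_mod _ _)

/-! ### Generated subalgebras, injectivity and conclusion. -/

theorem mem_subalg_iff {a : ℕ} {u : BInf} : u ∈ subalg a ↔ ∃ i, (a + 1) ⊳ i = u.val := by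
  obtain ⟨N, hN, -, -⟩ := exists_lt_two_pow (a + 1) 0 0
  have hlast : (a + 1) ⊳ (2 ^ N - 1) = a := op_last (Nat.succ_pos a) hN
  have ha : (⟨a⟩ : BInf) ∈ subalg a := Subsemigroup.subset_closure rfl
  constructor
  · intro h
    induction h using Subsemigroup.closure_induction with
    | mem v hv =>
      rw [Set.mem_singleton_iff] at hv
      exact ⟨2 ^ N - 1, by rw [hv, hlast]⟩
    | mul v w _ _ hv hw =>
      obtain ⟨i, hi⟩ := hv
      obtain ⟨j, hj⟩ := hw
      exact ⟨i ⊳ j, by rw [op_op_op, hi, hj]; rfl⟩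
  · rintro ⟨i, hi⟩
    obtain ⟨N, hN, hiN, -⟩ := exists_lt_two_pow (a + 1) i 0
    suffices H : ∀ j < 2 ^ N, (⟨(a + 1) ⊳ (2 ^ N - 1 - j)⟩ : BInf) ∈ subalg a by
      have := H (2 ^ N - 1 - i) (by omega)
      rw [show 2 ^ N - 1 - (2 ^ N - 1 - i) = i by omega, hi] at this
      exact this
    intro j hj
    induction j with
    | zero =>
      rw [Nat.sub_zero, op_last (Nat.succ_pos a) hN]
      exact ha
    | succ j ih =>
      rw [show 2 ^ N - 1 - (j + 1) = 2 ^ N - 1 - j - 1 by omega,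
        op_pred (Nat.succ_pos a) (by omega)]
      exact (subalg a).mul_mem (ih (by omega)) ha

/-- If the rows of `b + 1` and `a + 1` correspond under a map which is injective on the former,
then the subalgebras generated by `b` and `a` are isomorphic. -/
theorem exists_subalg_mulEquiv {a b : ℕ} {φ : ℕ → ℕ} (h : ∀ i, (a + 1) ⊳ i = φ ((b + 1) ⊳ i))
    (hφ : ∀ u ≤ b, ∀ v ≤ b, φ u = φ v → u = v) :
    ∃ Φ : subalg b ≃* subalg a, ∀ i : ℕ, ∃ hi : (⟨(b + 1) ⊳ i⟩ : BInf) ∈ subalg b,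
      (Φ ⟨⟨(b + 1) ⊳ i⟩, hi⟩ : BInf) = ⟨(a + 1) ⊳ i⟩ := by
  have hle : ∀ i, (b + 1) ⊳ i ≤ b := fun i => Nat.lt_succ_iff.1 (op_lt_left i (Nat.succ_pos b))
  let f : subalg b →ₙ* subalg a :=
    { toFun := fun u => ⟨⟨φ u.1.val⟩, by
        obtain ⟨i, hi⟩ := mem_subalg_iff.1 u.2
        exact mem_subalg_iff.2 ⟨i, by rw [h, hi]⟩⟩
      map_mul' := by
        rintro ⟨⟨u⟩, hu⟩ ⟨⟨v⟩, hv⟩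
        obtain ⟨i, hi⟩ := mem_subalg_iff.1 hu
        obtain ⟨j, hj⟩ := mem_subalg_iff.1 hv
        refine Subtype.ext (BInf.ext ?_)
        change φ (u ⊳ v) = φ u ⊳ φ v
        change _ = u at hi
        change _ = v at hj
        rw [← hi, ← hj, ← op_op_op, ← h, ← h, ← h, op_op_op] }
  have hf : Function.Bijective f := by
    constructor
    · rintro ⟨⟨u⟩, hu⟩ ⟨⟨v⟩, hv⟩ huv
      obtain ⟨i, rfl⟩ := mem_subalg_iff.1 hu
      obtain ⟨j, rfl⟩ := mem_subalg_iff.1 hv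
      exact Subtype.ext (BInf.ext (hφ _ (hle i) _ (hle j)
        (congrArg (fun t : subalg a => t.1.val) huv)))
    · rintro ⟨⟨u⟩, hu⟩
      obtain ⟨i, rfl⟩ := mem_subalg_iff.1 hu
      exact ⟨⟨⟨(b + 1) ⊳ i⟩, mem_subalg_iff.2 ⟨i, rfl⟩⟩, Subtype.ext (BInf.ext (h i).symm)⟩
  exact ⟨MulEquiv.ofBijective f hf, fun i => ⟨mem_subalg_iff.2 ⟨i, rfl⟩, BInf.ext (h i).symm⟩⟩

theorem IsPeriodLength.op_eq_zero {u p : ℕ} (h : IsPeriodLength u p) : u ⊳ p = 0 := by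
  have := h.1.2 0
  simpa [op_zero_right] using this

theorem IsPeriodLength.op_ne_zero {u l t : ℕ} (h : IsPeriodLength u (2 ^ l)) (hu : 0 < u)
    (ht0 : 0 < t) (ht : t < 2 ^ l) : u ⊳ t ≠ 0 := by
  intro h0
  obtain ⟨N, hN, -, -⟩ := exists_lt_two_pow u 0 0
  obtain ⟨q, -, H⟩ := exists_dvd_op_iff u N
  have hq : u ⊳ 2 ^ q = 0 :=
    Nat.eq_zero_of_dvd_of_lt ((H _).2 dvd_rfl) ((op_lt_left _ hu).trans hN)
  have h1 := h.2 ⟨by positivity, fun t => op_congr_right hq (Nat.add_modEq_right : t + 2 ^ q ≡ t [MOD 2 ^ q])⟩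
  have := Nat.le_of_dvd ht0 ((H t).1 (h0 ▸ dvd_zero _))
  omega

theorem IsPeriodLength.op_injOn {u l : ℕ} (h : IsPeriodLength u (2 ^ l)) (hu : 0 < u) :
    ∀ s < 2 ^ l, ∀ t < 2 ^ l, u ⊳ s = u ⊳ t → s = t := by
  have key : ∀ s t, s < t → t < 2 ^ l → u ⊳ s < u ⊳ t := fun s t hst ht =>
    op_lt_of_ne_zero hu hst fun r h1 h2 => h.op_ne_zero hu (by omega) (by omega)
  intro s hs t ht hst
  rcases lt_trichotomy s t with h1 | h1 | h1
  · exact absurd hst (key s t h1 ht).ne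
  · exact h1
  · exact absurd hst (key t s h1 hs).ne'

theorem digitMap_injOn {x p n l : ℕ} (hx : 2 ^ (p + n) ∣ x) (h : IsPeriodLength (x + 1) (2 ^ l)) :
    ∀ u < 2 ^ (n + l), ∀ v < 2 ^ (n + l), digitMap x p n u = digitMap x p n v → u = v := by
  have hn0 : 0 < 2 ^ n := by positivity
  have hp0 : 0 < 2 ^ p := by positivity
  intro u hu v hv huv
  have hdiv : ∀ t < 2 ^ (n + l), t / 2 ^ n < 2 ^ l := fun t ht =>
    Nat.div_lt_of_lt_mul (by rwa [← pow_add])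
  -- The row of x + 1 consists of multiples of 2^(p+n), so the lower digits can be read off.
  have hmod : ∀ t, digitMap x p n t % 2 ^ (p + n) = 2 ^ p * (t % 2 ^ n) := fun t => by
    obtain ⟨c, hc⟩ := dvd_succ_op hx (t / 2 ^ n)
    rw [digitMap, hc, Nat.mul_add_mod, Nat.mod_eq_of_lt]
    rw [pow_add]
    exact Nat.mul_lt_mul_of_pos_left (Nat.mod_lt t hn0) hp0
  have h1 : u % 2 ^ n = v % 2 ^ n :=
    Nat.eq_of_mul_eq_mul_left hp0 (by rw [← hmod, ← hmod, huv])
  unfold digitMap at huv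
  rw [h1] at huv
  have h2 := h.op_injOn (Nat.succ_pos x) _ (hdiv u hu) _ (hdiv v hv) (Nat.add_right_cancel huv)
  rw [← Nat.div_add_mod u (2 ^ n), ← Nat.div_add_mod v (2 ^ n), h1, h2]

end BackwardLaver

open BackwardLaver
theorem theorem4p1 (a x y m n l : ℕ) (hn : ∃ k : ℕ, n = 2 ^ k) (ha : a = x + 2 ^ (m * n) * y)
    (hy : y < 2 ^ n) (hx : 2 ^ ((m + 1) * n) ∣ x) (hl : IsPeriodLength (x + 1) (2 ^ l))
    (hln : l ≤ n) :
    (∃ φ : subalg (2 ^ (l + n) - 2 ^ n + y) ≃* subalg a,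
      ∀ i : ℕ, ∃ h : (⟨(2 ^ (l + n) - 2 ^ n + y + 1) ⊳ i⟩ : BInf) ∈
          subalg (2 ^ (l + n) - 2 ^ n + y),
        (φ ⟨⟨(2 ^ (l + n) - 2 ^ n + y + 1) ⊳ i⟩, h⟩ : BInf) = ⟨(a + 1) ⊳ i⟩) ∧
    ∀ i w y' : ℕ, y' < 2 ^ n → (2 ^ (l + n) - 2 ^ n + y + 1) ⊳ i = 2 ^ n * w + y' →
      (a + 1) ⊳ i = (x + 1) ⊳ w + 2 ^ (m * n) * y' := by
  obtain ⟨k, rfl⟩ := hn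
  rw [Nat.add_one_mul] at hx
  generalize hb : 2 ^ (l + 2 ^ k) - 2 ^ 2 ^ k + y = b
  have hb' : b = 2 ^ 2 ^ k * (2 ^ l - 1) + y := by
    rw [← hb, Nat.mul_sub, Nat.mul_one, pow_add, Nat.mul_comm]
  have hblt : b < 2 ^ (2 ^ k + l) := by
    have : 2 ^ 2 ^ k ≤ 2 ^ (2 ^ k + l) := Nat.pow_le_pow_right (by decide) (by omega)
    rw [Nat.add_comm l] at hb
    omega
  have hn := (shifts_two_pow (2 ^ k) k dvd_rfl).mono hln
  have hp := shifts_two_pow (m * 2 ^ k) k (Dvd.intro_left _ rfl)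
  have hM := (shifts_two_pow (m * 2 ^ k + 2 ^ k) k
    (dvd_add (Dvd.intro_left _ rfl) dvd_rfl)).mono hln
  have hrow : ∀ i, (a + 1) ⊳ i = digitMap x (m * 2 ^ k) (2 ^ k) ((b + 1) ⊳ i) := by
    intro i
    have h1 := op_of_left_powers (φ := digitMap x (m * 2 ^ k) (2 ^ k)) (Nat.succ_pos b)
      (fun v hv => digitMap_op hn hp hM hx hl.op_eq_zero v (by omega) _ hblt) i
    rwa [Nat.succ_sub_one, hb', digitMap_mul_add _ _ _ hy, succ_op_last hl.op_eq_zero, ← ha,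
      ← hb'] at h1
  refine ⟨exists_subalg_mulEquiv hrow fun u hu v hv =>
    digitMap_injOn hx hl u (by omega) v (by omega), fun i w y' hy' h => ?_⟩
  rw [hrow, h, digitMap_mul_add _ _ _ hy']
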